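/- Let $n\in\mathbb N$ and let $d=(d_1,\dots,d_n)$ and $p=(p_1,\dots,p_n)$ be probability vectors. For probability vectors $a,b$ of length $n$ write $a\succ b$ ($a$ majorizes $b$) if for every $k=1,\dots,n$ the sum of the $k$ largest components of $a$ is at least the sum of the $k$ largest components of $b$. A majorization join of $d$ and $p$ is a probability vector $c$ with $c\succ d$ and $c\succ p$ such that $\tilde c\succ c$ for every probability vector $\tilde c$ with $\tilde c\succ d$ and $\tilde c\succ p$. Let $S(a)=-\sum_i a_i\log_2 a_i$ be the Shannon entropy, and for a density matrix $\rho$ on $\mathbb C^n$ let $C_r(\rho)=\min_\delta S(\rho\|\delta)$ be the relative entropy of coherence, where $\delta$ runs over the density matrices that are diagonal in the fixed standard basis and $S(\rho\|\delta)=\operatorname{Tr}(\rho\log_2\rho-\rho\log_2\delta)$ ($=+\infty$ if the support of $\rho$ is not contained in that of $\delta$). Then $d$ and $p$ have exactly one majorization join with components in descending order, denoted $d\vee p$. Moreover, for $c=d\vee p$ (and likewise for any other majorization join $c$ of $d$ and $p$) there exist a density matrix $\rho$ on $\mathbb C^n$ and a von Neumann measurement $\{P_i\}_{i=1}^n$ (mutually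 orthogonal rank-one orthogonal projectors with $\sum_i P_i=I$) such that (i) $\rho_{ii}=d_i$ for all $i$; (ii) $\operatorname{Tr}(P_i\rho)=p_i$ for all $i$; (iii) the eigenvalues of $\rho$, counted with multiplicity, are $c_1,\dots,c_n$; and for this $\rho$ the minimum defining $C_r(\rho)$ is attained and $C_r(\rho)=S(d)-S(d\vee p)$. That is, the lower bound $C_r(\rho)\ge S(d)-S(d\vee p)$ is attained. -/

import Mathlib

open scoped ComplexOrder

namespace CoherenceEstimation

noncomputable section

/-- The components of `a`, rearranged in descending order. -/
def sortDesc {n : ℕ} (a : Fin n → ℝ) : Fin n → ℝ :=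
  fun i => a (Tuple.sort a (Fin.rev i))

theorem antitone_sortDesc {n : ℕ} (a : Fin n → ℝ) : Antitone (sortDesc a) :=
  fun _ _ hij => Tuple.monotone_sort a (Fin.rev_le_rev.mpr hij)

/-- `Majorizes a b` is `a ≻ b` for probability vectors `a`, `b`: the sum of the `k` largest
components of `a` is at least the sum of the `k` largest components of `b`, for `k = 1, …, n`. -/
def Majorizes {n : ℕ} (a b : Fin n → ℝ) : Prop :=
  ∀ k : ℕ, 1 ≤ k → k ≤ n →
    ∑ i : Fin n with i.val < k, sortDesc b i ≤ ∑ i : Fin n with i.val < k, sortDesc a i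

/-- `c` is a majorization join of `a` and `b`: a smallest probability vector majorizing both. -/
structure IsMajorizationJoin {n : ℕ} (a b c : Fin n → ℝ) : Prop where
  mem_simplex : c ∈ stdSimplex ℝ (Fin n)
  majorizes_left : Majorizes c a
  majorizes_right : Majorizes c b
  least : ∀ c' ∈ stdSimplex ℝ (Fin n), Majorizes c' a → Majorizes c' b → Majorizes c' c

/-- The Shannon entropy in bits, `-∑ pᵢ log₂ pᵢ` with `0 log₂ 0 = 0`. -/
def shannonEntropy {n : ℕ} (p : Fin n → ℝ) : ℝ :=
  -∑ i, p i * Real.logb 2 (p i)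

/-- Density matrices, written in the incoherent basis. -/
structure IsState {n : ℕ} (ρ : Matrix (Fin n) (Fin n) ℂ) : Prop where
  posSemidef : ρ.PosSemidef
  trace_eq_one : ρ.trace = 1

/-- Incoherent states `∑ qᵢ |i⟩⟨i|`, with `q` a probability vector. -/
def IsIncoherent {n : ℕ} (δ : Matrix (Fin n) (Fin n) ℂ) : Prop :=
  ∃ q ∈ stdSimplex ℝ (Fin n), δ = Matrix.diagonal (fun i => (q i : ℂ))

/-- A von Neumann measurement: a complete family of mutually orthogonal rank-one projectors,
that is, the projectors onto the vectors of an orthonormal basis. -/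
structure IsVonNeumannMeasurement {n : ℕ} (P : Fin n → Matrix (Fin n) (Fin n) ℂ) : Prop where
  isHermitian : ∀ i, (P i).IsHermitian
  idempotent : ∀ i, P i * P i = P i
  orthogonal : ∀ i j, i ≠ j → P i * P j = 0
  rank_eq_one : ∀ i, (P i).rank = 1
  sum_eq_one : ∑ i, P i = 1

/-- The vector `c` lists the eigenvalues of `ρ`, with multiplicity, in some order. -/
def HasSpectrum {n : ℕ} (ρ : Matrix (Fin n) (Fin n) ℂ) (c : Fin n → ℝ) : Prop :=
  ρ.charpoly.roots = Finset.univ.val.map (fun i => (c i : ℂ))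

/-- The base-two logarithm of a Hermitian matrix, by functional calculus; it is `0` on the
kernel. -/
def matLog {n : ℕ} (A : Matrix (Fin n) (Fin n) ℂ) : Matrix (Fin n) (Fin n) ℂ :=
  cfc (Real.logb 2) A

open Classical in
/-- The quantum relative entropy `S(ρ‖δ) = Tr(ρ log₂ ρ - ρ log₂ δ)` of two states, which is `+∞`
unless the support of `ρ` lies in that of `δ`, i.e. unless `ker δ ⊆ ker ρ`. -/
def relativeEntropy {n : ℕ} (ρ δ : Matrix (Fin n) (Fin n) ℂ) : EReal :=
  if ∀ v : Fin n → ℂ, Matrix.mulVec δ v = 0 → Matrix.mulVec ρ v = 0 then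
    (((ρ * matLog ρ - ρ * matLog δ).trace.re : ℝ) : EReal)
  else ⊤

/-- `C_r(ρ) = r`, where `C_r(ρ) = min S(ρ‖δ)` over all incoherent states `δ`. The minimum is
attained. -/
def RelEntropyCoherenceEq {n : ℕ} (ρ : Matrix (Fin n) (Fin n) ℂ) (r : ℝ) : Prop :=
  IsLeast {s : EReal | ∃ δ, IsIncoherent δ ∧ s = relativeEntropy ρ δ} (r : EReal)

end

end CoherenceEstimation

/-! The pointwise infimum of the sorted partial sums of all common majorants of `d` and `p` is again
increasing and concave, so its increments form a descending probability vector: the join.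
Majorization is antisymmetric up to reordering, which gives uniqueness.

Since `c ≻ d` and `c ≻ p`, Horn's theorem gives unitaries `U`, `V` such that `U diag(c) U*` has
diagonal `d` and `V diag(c) V*` has diagonal `p`. Take `ρ = U diag(c) U*` and measure in the columns
of `W = U V*`: then `W* ρ W = V diag(c) V*`, so the outcome probabilities are `p`. Horn's theorem
itself is proved by plane rotations, each correcting at least one diagonal entry.

For incoherent `diag(q)`, a finite relative entropy equals `-S(c) - ∑ dᵢ log₂ qᵢ`; by Gibbs'
inequality it is least at `q = d`. -/

namespace CoherenceEstimation

/-! ### Partial sums and majorization -/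

/-- The sum of the first `k` components of `a`. -/
def partialSum {n : ℕ} (a : Fin n → ℝ) (k : ℕ) : ℝ :=
  ∑ i : Fin n with i.val < k, a i

@[simp]
theorem partialSum_zero {n : ℕ} (a : Fin n → ℝ) : partialSum a 0 = 0 := by
  simp [partialSum]

theorem partialSum_succ {n : ℕ} (a : Fin n → ℝ) (i : Fin n) :
    partialSum a (i + 1) = partialSum a i + a i := by
  have h : (Finset.univ.filter fun j : Fin n => j.val < i.val + 1) =
      insert i (Finset.univ.filter fun j : Fin n => j.val < i.val) := by
    ext j
    simp only [Finset.mem_filter, Finset.mem_univ, true_and, Finset.mem_insert, Fin.ext_iff]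
    omega
  rw [partialSum, h, Finset.sum_insert (by simp), partialSum, add_comm]

theorem partialSum_of_le {n : ℕ} (a : Fin n → ℝ) {k : ℕ} (hk : n ≤ k) :
    partialSum a k = ∑ i, a i := by
  rw [partialSum, Finset.filter_true_of_mem fun i _ => i.isLt.trans_le hk]

theorem eq_of_partialSum_eq {n : ℕ} {a b : Fin n → ℝ}
    (h : ∀ k ≤ n, partialSum a k = partialSum b k) : a = b := by
  funext i
  have h₁ := h (i + 1) i.isLt
  rw [partialSum_succ, partialSum_succ, h i i.isLt.le] at h₁
  linarith

/-- The permutation that arranges `a` in descending order. -/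
noncomputable def descPerm {n : ℕ} (a : Fin n → ℝ) : Equiv.Perm (Fin n) :=
  Fin.revPerm.trans (Tuple.sort a)

theorem comp_descPerm {n : ℕ} (a : Fin n → ℝ) : a ∘ descPerm a = sortDesc a := rfl

theorem sum_sortDesc {n : ℕ} (a : Fin n → ℝ) : ∑ i, sortDesc a i = ∑ i, a i :=
  Equiv.sum_comp (descPerm a) a

theorem sortDesc_eq_self {n : ℕ} {a : Fin n → ℝ} (ha : Antitone a) : sortDesc a = a :=
  Tuple.unique_antitone (σ := descPerm a) (τ := Equiv.refl _) (antitone_sortDesc a) ha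

theorem majorizes_iff {n : ℕ} {a b : Fin n → ℝ} :
    Majorizes a b ↔ ∀ k ≤ n, partialSum (sortDesc b) k ≤ partialSum (sortDesc a) k := by
  refine ⟨fun h k hk => ?_, fun h k _ hk => h k hk⟩
  rcases Nat.eq_zero_or_pos k with rfl | hk₀
  · simp
  · exact h k hk₀ hk

theorem Majorizes.antisymm {n : ℕ} {a b : Fin n → ℝ} (hab : Majorizes a b)
    (hba : Majorizes b a) : sortDesc a = sortDesc b :=
  eq_of_partialSum_eq fun k hk =>
    le_antisymm (majorizes_iff.1 hba k hk) (majorizes_iff.1 hab k hk)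

theorem sortDesc_mem_stdSimplex {n : ℕ} {a : Fin n → ℝ} (ha : a ∈ stdSimplex ℝ (Fin n)) :
    sortDesc a ∈ stdSimplex ℝ (Fin n) :=
  ⟨fun _ => ha.1 _, (sum_sortDesc a).trans ha.2⟩

theorem partialSum_nonneg {n : ℕ} {a : Fin n → ℝ} (ha : a ∈ stdSimplex ℝ (Fin n)) (k : ℕ) :
    0 ≤ partialSum a k :=
  Finset.sum_nonneg fun i _ => ha.1 i

theorem partialSum_le_one {n : ℕ} {a : Fin n → ℝ} (ha : a ∈ stdSimplex ℝ (Fin n)) (k : ℕ) :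
    partialSum a k ≤ 1 :=
  ha.2 ▸ Finset.sum_le_univ_sum_of_nonneg fun i => ha.1 i

theorem partialSum_mono {n : ℕ} {a : Fin n → ℝ} (ha : a ∈ stdSimplex ℝ (Fin n)) :
    Monotone (partialSum a) := fun _ _ hkl =>
  Finset.sum_le_sum_of_subset_of_nonneg
    (Finset.monotone_filter_right _ fun _ _ h => h.trans_le hkl) fun i _ _ => ha.1 i

/-- The increments are the components of `a`, which descend; beyond `n` the sums are constant. -/
theorem partialSum_concave {n : ℕ} {a : Fin n → ℝ} (ha : a ∈ stdSimplex ℝ (Fin n))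
    (hanti : Antitone a) (k : ℕ) :
    partialSum a (k + 2) + partialSum a k ≤ 2 * partialSum a (k + 1) := by
  rcases lt_or_ge (k + 1) n with h | h
  · have h₁ := partialSum_succ a ⟨k + 1, h⟩
    have h₂ := partialSum_succ a ⟨k, by omega⟩
    have h₃ : a ⟨k + 1, h⟩ ≤ a ⟨k, by omega⟩ := hanti (Fin.mk_le_mk.2 k.le_succ)
    simp only at h₁ h₂
    rw [show k + 2 = k + 1 + 1 from rfl]
    linarith
  · have h₁ := partialSum_mono ha k.le_succ
    rw [partialSum_of_le a (h.trans (Nat.le_succ _)), ← partialSum_of_le a h]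
    simp only [Nat.succ_eq_add_one] at h₁
    linarith

/-! ### The majorization join -/

/-- Two probability vectors have a majorization join: its partial sums are the infima of those of
the common upper bounds. -/
theorem exists_antitone_isMajorizationJoin {n : ℕ} {d p : Fin n → ℝ}
    (hd : d ∈ stdSimplex ℝ (Fin n)) (hp : p ∈ stdSimplex ℝ (Fin n)) :
    ∃ c : Fin n → ℝ, Antitone c ∧ IsMajorizationJoin d p c := by
  have hn : 0 < n := by
    rcases Nat.eq_zero_or_pos n with rfl | h
    · simpa using hd.2
    · exact h
  let T := {a : Fin n → ℝ // a ∈ stdSimplex ℝ (Fin n) ∧ Majorizes a d ∧ Majorizes a p}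
  let g : ℕ → ℝ := fun k => ⨅ a : T, partialSum (sortDesc a.1) k
  have hS : ∀ a : T, sortDesc a.1 ∈ stdSimplex ℝ (Fin n) :=
    fun a => sortDesc_mem_stdSimplex a.2.1
  -- The point mass majorizes every probability vector, so the infimum is not over the empty set.
  have hT : Nonempty T := by
    let e : Fin n → ℝ := Pi.single ⟨0, hn⟩ 1
    have he : e ∈ stdSimplex ℝ (Fin n) := single_mem_stdSimplex ℝ _
    have hanti : Antitone e := by
      intro i j hij
      simp only [e, Pi.single_apply, Fin.ext_iff]
      have : i.val ≤ j.val := hij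
      split_ifs <;> first | omega | norm_num
    have hmaj : ∀ a ∈ stdSimplex ℝ (Fin n), Majorizes e a := by
      intro a ha k hk _
      change partialSum _ _ ≤ partialSum _ _
      rw [sortDesc_eq_self hanti]
      refine (partialSum_le_one (sortDesc_mem_stdSimplex ha) k).trans ?_
      refine le_trans ?_ (partialSum_mono he hk)
      have := partialSum_succ e ⟨0, hn⟩
      simp only [zero_add, partialSum_zero] at this
      simp [this, e]
    exact ⟨e, he, hmaj d hd, hmaj p hp⟩
  have hbdd : ∀ k, BddBelow (Set.range fun a : T => partialSum (sortDesc a.1) k) :=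
    fun k => ⟨0, by rintro _ ⟨a, rfl⟩; exact partialSum_nonneg (hS a) k⟩
  have hle : ∀ (a : T) k, g k ≤ partialSum (sortDesc a.1) k := fun a k => ciInf_le (hbdd k) a
  have hmono : Monotone g := fun k l hkl =>
    ciInf_mono (hbdd k) fun a => partialSum_mono (hS a) hkl
  -- An infimum of concave sequences is concave. Hence the increments of `g` are already sorted, and
  -- `g` gives the sums that majorization compares.
  have hconc : Antitone fun k => g (k + 1) - g k := by
    refine antitone_nat_of_succ_le fun k => ?_
    have : (g (k + 2) + g k) / 2 ≤ g (k + 1) := le_ciInf fun a => by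
      have := partialSum_concave (hS a) (antitone_sortDesc _) k
      have := hle a k
      have := hle a (k + 2)
      linarith
    change g (k + 2) - g (k + 1) ≤ g (k + 1) - g k
    linarith
  have hg0 : g 0 = 0 := by simp [g]
  have hgn : g n = 1 := by
    have : ∀ a : T, partialSum (sortDesc a.1) n = 1 :=
      fun a => (partialSum_of_le _ le_rfl).trans (hS a).2
    simp [g, this]
  let c : Fin n → ℝ := fun i => g (i + 1) - g i
  have hc : Antitone c := fun i j hij => hconc (Fin.le_def.1 hij)
  have hcg : ∀ k ≤ n, partialSum c k = g k := by
    intro k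
    induction k with
    | zero => intro _; simp [hg0]
    | succ k ih =>
      intro hk
      have := partialSum_succ c ⟨k, hk⟩
      simp only at this
      rw [this, ih (by omega)]
      simp [c]
  have hcmem : c ∈ stdSimplex ℝ (Fin n) :=
    ⟨fun i => sub_nonneg.2 (hmono (Nat.le_succ _)), by
      rw [← partialSum_of_le c le_rfl, hcg n le_rfl, hgn]⟩
  refine ⟨c, hc, hcmem, ?_, ?_, fun c' h₁ h₂ h₃ => ?_⟩ <;> rw [majorizes_iff] <;> intro k hk <;>
    rw [sortDesc_eq_self hc, hcg k hk]
  · exact le_ciInf fun a => majorizes_iff.1 a.2.2.1 k hk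
  · exact le_ciInf fun a => majorizes_iff.1 a.2.2.2 k hk
  · exact hle ⟨c', h₁, h₂, h₃⟩ k

theorem existsUnique_antitone_isMajorizationJoin {n : ℕ} {d p : Fin n → ℝ}
    (hd : d ∈ stdSimplex ℝ (Fin n)) (hp : p ∈ stdSimplex ℝ (Fin n)) :
    ∃! c : Fin n → ℝ, Antitone c ∧ IsMajorizationJoin d p c := by
  obtain ⟨c, hc, hj⟩ := exists_antitone_isMajorizationJoin hd hp
  refine ⟨c, ⟨hc, hj⟩, fun b ⟨hb, hj'⟩ => ?_⟩
  rw [← sortDesc_eq_self hb, ← sortDesc_eq_self hc]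
  exact Majorizes.antisymm
    (hj.least b hj'.mem_simplex hj'.majorizes_left hj'.majorizes_right)
    (hj'.least c hj.mem_simplex hj.majorizes_left hj.majorizes_right)

/-! ### Plane rotations -/

/-- The rotation by the angle `θ` in the plane of the coordinates `j` and `k`. -/
noncomputable def planeRotation {n : ℕ} (j k : Fin n) (θ : ℝ) : Matrix (Fin n) (Fin n) ℂ :=
  Matrix.of fun i =>
    if i = j then (Real.cos θ : ℂ) • Pi.single j 1 + (Real.sin θ : ℂ) • Pi.single k 1
    else if i = k then (Real.cos θ : ℂ) • Pi.single k 1 - (Real.sin θ : ℂ) • Pi.single j 1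
    else Pi.single i 1

theorem row_planeRotation_left {n : ℕ} (j k : Fin n) (θ : ℝ) :
    (planeRotation j k θ).row j =
      (Real.cos θ : ℂ) • Pi.single j 1 + (Real.sin θ : ℂ) • Pi.single k 1 :=
  if_pos rfl

theorem row_planeRotation_right {n : ℕ} {j k : Fin n} (hjk : j ≠ k) (θ : ℝ) :
    (planeRotation j k θ).row k =
      (Real.cos θ : ℂ) • Pi.single k 1 - (Real.sin θ : ℂ) • Pi.single j 1 :=
  (if_neg hjk.symm).trans (if_pos rfl)

theorem row_planeRotation_of_ne {n : ℕ} {i j k : Fin n} (hij : i ≠ j) (hik : i ≠ k) (θ : ℝ) :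
    (planeRotation j k θ).row i = Pi.single i 1 :=
  (if_neg hij).trans (if_neg hik)

theorem planeRotation_mem_unitaryGroup {n : ℕ} {j k : Fin n} (hjk : j ≠ k) (θ : ℝ) :
    planeRotation j k θ ∈ Matrix.unitaryGroup (Fin n) ℂ := by
  have hcs : (Real.cos θ : ℂ) * Real.cos θ + Real.sin θ * Real.sin θ = 1 := by
    have := Real.cos_sq_add_sin_sq θ
    rw [sq, sq] at this
    exact_mod_cast this
  have hkj := hjk.symm
  rw [Matrix.mem_unitaryGroup_iff]
  ext i l
  have h : (planeRotation j k θ * star (planeRotation j k θ)) i l =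
      (planeRotation j k θ).row i ⬝ᵥ star ((planeRotation j k θ).row l) := rfl
  rw [h]
  have hrow : ∀ i, (i = j ∨ i = k) ∨ i ≠ j ∧ i ≠ k := fun i => by tauto
  rcases hrow i with (rfl | rfl) | ⟨hij, hik⟩ <;> rcases hrow l with (rfl | rfl) | ⟨hlj, hlk⟩ <;>
    simp only [row_planeRotation_left, row_planeRotation_right, row_planeRotation_of_ne, ne_eq,
      not_false_eq_true, *] <;>
    simp [Matrix.one_apply, Pi.single_apply, Ne.symm,
      -Complex.ofReal_cos, -Complex.ofReal_sin, *] <;>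
    first | done | linear_combination hcs | ring1 | simp only [eq_comm]

theorem conj_apply_self {n : ℕ} (U A : Matrix (Fin n) (Fin n) ℂ) (i : Fin n) :
    (U * A * star U) i i = U.row i ⬝ᵥ (A.mulVec (star (U.row i))) := by
  rw [Matrix.dotProduct_mulVec]
  rfl

/-- A rotation in the plane of the coordinates `j` and `k` moves the diagonal entry at `j` to any
value between the diagonal entries at `k` and `j`. -/
theorem exists_unitary_conj_diag_eq {n : ℕ} {A : Matrix (Fin n) (Fin n) ℂ} {j k : Fin n}
    (hjk : j ≠ k) {t : ℝ} (hk : (A k k).re ≤ t) (hj : t ≤ (A j j).re) :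
    ∃ U ∈ Matrix.unitaryGroup (Fin n) ℂ,
      ((U * A * star U) j j).re = t ∧
      ((U * A * star U) k k).re = (A j j).re + (A k k).re - t ∧
      ∀ i, i ≠ j → i ≠ k → (U * A * star U) i i = A i i := by
  -- The `j`-th diagonal entry after rotation by `θ`: it is `A j j` at `0` and `A k k` at `π / 2`
  -- (real parts), so it takes the value `t` in between.
  let f : ℝ → ℝ := fun θ => Real.cos θ ^ 2 * (A j j).re + Real.sin θ ^ 2 * (A k k).re +
    Real.cos θ * Real.sin θ * ((A j k).re + (A k j).re)
  have hf : Continuous f := by fun_prop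
  obtain ⟨θ, -, hθ⟩ : t ∈ f '' Set.Icc 0 (Real.pi / 2) := by
    refine intermediate_value_Icc' (by positivity) hf.continuousOn ⟨?_, ?_⟩ <;> simpa [f]
  have hcs := Real.cos_sq_add_sin_sq θ
  refine ⟨planeRotation j k θ, planeRotation_mem_unitaryGroup hjk θ, ?_, ?_, fun i hij hik => ?_⟩
  · rw [conj_apply_self, ← hθ, row_planeRotation_left]
    simp [Matrix.mulVec_add, Matrix.mulVec_smul, add_dotProduct,
      -Complex.ofReal_cos, -Complex.ofReal_sin, f]
    ring
  · rw [conj_apply_self, ← hθ, row_planeRotation_right hjk]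
    simp [Matrix.mulVec_sub, Matrix.mulVec_smul, sub_dotProduct,
      -Complex.ofReal_cos, -Complex.ofReal_sin, f]
    linear_combination ((A j j).re + (A k k).re) * hcs
  · rw [conj_apply_self, row_planeRotation_of_ne hij hik]
    simp

/-! ### Horn's theorem -/

theorem partialSum_lt_of_lt {n : ℕ} {a b : Fin n → ℝ} {k : Fin n} (h : ∀ i < k, a i ≤ b i)
    (hk : a k < b k) : partialSum a (k + 1) < partialSum b (k + 1) := by
  rw [partialSum_succ, partialSum_succ]
  exact add_lt_add_of_le_of_lt
    (Finset.sum_le_sum fun i hi => h i (Fin.lt_def.2 (by simpa using hi))) hk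

/-- If the partial sums of `a` dominate those of `d`, with equal totals, and `a ≠ d`, then there
are `j < k` with `d j < a j` and `a k < d k` between which `a` and `d` agree. -/
theorem exists_adjacent_disagreement {n : ℕ} {a d : Fin n → ℝ}
    (hle : ∀ k ≤ n, partialSum d k ≤ partialSum a k) (hsum : ∑ i, a i = ∑ i, d i) (hne : a ≠ d) :
    ∃ j k : Fin n, j < k ∧ d j < a j ∧ a k < d k ∧ ∀ i, j < i → i < k → a i = d i := by
  have hex : ∃ k, a k < d k := by
    by_contra! h
    exact hne (funext fun i =>
      ((Finset.sum_eq_sum_iff_of_le fun i _ => h i).1 hsum.symm i (Finset.mem_univ i)).symm)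
  -- Take the first deficit `k`, then the last surplus `j` before it; without such a surplus the
  -- partial sum through `k` would be too small.
  obtain ⟨k, hk, hkmin⟩ : ∃ k, a k < d k ∧ ∀ i < k, d i ≤ a i := by
    obtain ⟨k, hk⟩ := exists_minimal_of_wellFoundedLT (fun k => a k < d k) hex
    exact ⟨k, hk.prop, fun i hi => not_lt.1 (hk.not_prop_of_lt hi)⟩
  have hex' : ∃ j, j < k ∧ d j < a j := by
    by_contra! h
    exact (hle (k + 1) k.isLt).not_gt (partialSum_lt_of_lt h hk)
  obtain ⟨j, hj⟩ := exists_maximal_of_wellFoundedGT (fun j => j < k ∧ d j < a j) hex'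
  exact ⟨j, k, hj.prop.1, hj.prop.2, hk, fun i hji hik => le_antisymm
    (not_lt.1 fun h => hj.not_prop_of_gt hji ⟨hik, h⟩) (hkmin i hik)⟩

/-- Only a partial sum that includes `j` but not `k` notices a transfer from `j` to `k`. -/
theorem partialSum_transfer {n : ℕ} {a b : Fin n → ℝ} {j k : Fin n} (hjk : j < k) {δ : ℝ}
    (hj : b j = a j - δ) (hk : b k = a k + δ) (h : ∀ i, i ≠ j → i ≠ k → b i = a i) (m : ℕ) :
    partialSum b m = partialSum a m - if j.val < m ∧ m ≤ k.val then δ else 0 := by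
  have hb : b = a + (Pi.single k δ - Pi.single j δ) := by
    funext i
    by_cases hij : i = j
    · subst hij; simp [hj, hjk.ne]; ring
    · by_cases hik : i = k
      · subst hik; simp [hk, hij]
      · simp [h i hij hik, hij, hik]
  have hjk' : j.val < k.val := hjk
  simp only [hb, partialSum, Pi.add_apply, Pi.sub_apply, Finset.sum_add_distrib,
    Finset.sum_sub_distrib, Finset.sum_pi_single', Finset.mem_filter, Finset.mem_univ, true_and]
  split_ifs <;> first | omega | ring

/-- A Hermitian matrix whose diagonal dominates `d` is unitarily conjugate to one with the
diagonal `d`. -/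
theorem exists_unitary_conj_diag {n : ℕ} {d : Fin n → ℝ} (hd : Antitone d)
    (A : Matrix (Fin n) (Fin n) ℂ) (hA : A.IsHermitian)
    (hle : ∀ k ≤ n, partialSum d k ≤ partialSum (fun i => (A i i).re) k)
    (hsum : ∑ i, (A i i).re = ∑ i, d i) :
    ∃ U ∈ Matrix.unitaryGroup (Fin n) ℂ, ∀ i, (U * A * star U) i i = (d i : ℂ) := by
  induction hN : (Finset.univ.filter fun i => (A i i).re ≠ d i).card using Nat.strong_induction_on
    generalizing A with
  | _ N ih =>
  by_cases hne : (fun i => (A i i).re) = d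
  · refine ⟨1, one_mem _, fun i => ?_⟩
    rw [one_mul, star_one, mul_one, ← congrFun hne i]
    exact (hA.coe_re_apply_self i).symm
  obtain ⟨j, k, hjk, hj, hk, hmid⟩ := exists_adjacent_disagreement hle hsum hne
  have hdjk := hd hjk.le
  -- The largest transfer that overshoots neither target; it makes one of the two entries exact. As
  -- `A k k < d k ≤ d j < A j j`, the new entry at `j` stays in the range of the rotation.
  set δ := min ((A j j).re - d j) (d k - (A k k).re) with hδ
  have hδ₁ : δ ≤ (A j j).re - d j := min_le_left _ _
  have hδ₂ : δ ≤ d k - (A k k).re := min_le_right _ _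
  have hδ₀ : 0 < δ := lt_min (by linarith) (by linarith)
  obtain ⟨U, hU, hUj, hUk, hUi⟩ := exists_unitary_conj_diag_eq (A := A) hjk.ne
    (t := (A j j).re - δ) (by linarith) (by linarith)
  set B := U * A * star U with hB
  have hBA : ∀ m, partialSum (fun i => (B i i).re) m =
      partialSum (fun i => (A i i).re) m - if j.val < m ∧ m ≤ k.val then δ else 0 :=
    partialSum_transfer hjk hUj (by linarith) fun i hij hik => by rw [hUi i hij hik]
  have hBh : B.IsHermitian := by
    rw [hB, Matrix.star_eq_conjTranspose]
    exact Matrix.isHermitian_mul_mul_conjTranspose U hA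
  have hBsum : ∑ i, (B i i).re = ∑ i, d i := by
    rw [← hsum, ← partialSum_of_le _ le_rfl, hBA, if_neg (by omega), sub_zero,
      partialSum_of_le _ le_rfl]
  -- The surplus at `j` gives slack `δ` just after `j`, and the slack persists up to `k` because the
  -- entries in between agree.
  have hgap : ∀ m : ℕ, j.val < m → m ≤ k.val →
      partialSum d m + δ ≤ partialSum (fun i => (A i i).re) m := by
    intro m hm
    induction m, hm using Nat.le_induction with
    | base =>
      intro _
      have h₁ := partialSum_succ d j
      have h₂ := partialSum_succ (fun i => (A i i).re) j
      have h₃ := hle j j.isLt.le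
      simp only [Nat.succ_eq_add_one]
      linarith
    | succ m hm ihm =>
      intro hmk
      have h₁ := partialSum_succ d ⟨m, by omega⟩
      have h₂ := partialSum_succ (fun i => (A i i).re) ⟨m, by omega⟩
      have h₃ := hmid ⟨m, by omega⟩ (Fin.lt_def.2 hm) (Fin.lt_def.2 hmk)
      have h₄ := ihm (by omega)
      simp only at h₁ h₂
      linarith
  have hBle : ∀ m ≤ n, partialSum d m ≤ partialSum (fun i => (B i i).re) m := by
    intro m hm
    rw [hBA]
    split_ifs with h
    · have := hgap m h.1 h.2
      linarith
    · simpa using hle m hm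
  have hcard : (Finset.univ.filter fun i => (B i i).re ≠ d i).card < N := by
    rw [← hN]
    refine Finset.card_lt_card (Finset.ssubset_iff_of_subset ?_ |>.2 ?_)
    · intro i
      simp only [Finset.mem_filter, Finset.mem_univ, true_and]
      by_cases hij : i = j
      · subst hij; exact fun _ => hj.ne'
      · by_cases hik : i = k
        · subst hik; exact fun _ => hk.ne
        · rw [hUi i hij hik]; exact id
    · rcases min_choice ((A j j).re - d j) (d k - (A k k).re) with h | h
      · refine ⟨j, by simpa using hj.ne', ?_⟩
        simp only [Finset.mem_filter, Finset.mem_univ, true_and, not_not]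
        linarith
      · refine ⟨k, by simpa using hk.ne, ?_⟩
        simp only [Finset.mem_filter, Finset.mem_univ, true_and, not_not]
        linarith
  obtain ⟨V, hV, hVd⟩ := ih _ hcard B hBh hBle hBsum rfl
  refine ⟨V * U, mul_mem hV hU, fun i => ?_⟩
  rw [← hVd i, hB, star_mul]
  simp only [mul_assoc]

/-- Horn's half of the Schur–Horn theorem. -/
theorem Majorizes.exists_unitary_conj_diagonal {n : ℕ} {c d : Fin n → ℝ} (h : Majorizes c d)
    (hsum : ∑ i, c i = ∑ i, d i) :
    ∃ U ∈ Matrix.unitaryGroup (Fin n) ℂ,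
      ∀ i, (U * Matrix.diagonal (fun i => (c i : ℂ)) * star U) i i = (d i : ℂ) := by
  obtain ⟨V, hV, hVd⟩ := exists_unitary_conj_diag (antitone_sortDesc d)
    (Matrix.diagonal fun i => (sortDesc c i : ℂ))
    (Matrix.isHermitian_diagonal_iff.2 fun i => Complex.conj_ofReal _)
    (by simpa using majorizes_iff.1 h) (by simpa [sum_sortDesc] using hsum)
  set σ := descPerm c
  set τ := descPerm d
  -- Permuting the rows and columns of `V` undoes both sortings.
  have hsub : V.submatrix τ.symm σ.symm * Matrix.diagonal (fun i => (c i : ℂ)) *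
      star (V.submatrix τ.symm σ.symm) =
      (V * (Matrix.diagonal fun i => (sortDesc c i : ℂ)) * star V).submatrix τ.symm τ.symm := by
    have hc : Matrix.diagonal (fun i => (c i : ℂ)) =
        (Matrix.diagonal fun i => (sortDesc c i : ℂ)).submatrix σ.symm σ.symm := by
      rw [Matrix.submatrix_diagonal_equiv]
      congr 1
      funext i
      simp [← comp_descPerm, σ]
    rw [hc, Matrix.star_eq_conjTranspose, Matrix.conjTranspose_submatrix,
      Matrix.submatrix_mul_equiv, Matrix.submatrix_mul_equiv]
    rfl
  refine ⟨V.submatrix τ.symm σ.symm, ?_, fun i => ?_⟩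
  · rw [Matrix.mem_unitaryGroup_iff, Matrix.star_eq_conjTranspose,
      Matrix.conjTranspose_submatrix, Matrix.submatrix_mul_equiv, ← Matrix.star_eq_conjTranspose,
      Matrix.mem_unitaryGroup_iff.1 hV, Matrix.submatrix_one_equiv]
  · rw [hsub, Matrix.submatrix_apply, hVd, ← comp_descPerm]
    simp [τ]

/-! ### Functional calculus and conjugated diagonal matrices -/

open Polynomial in
/-- On a matrix in the image of a real algebra homomorphism from `Fin n → ℝ`, the functional calculus
acts componentwise. -/
theorem cfc_algHom_apply {n : ℕ} (φ : (Fin n → ℝ) →ₐ[ℝ] Matrix (Fin n) (Fin n) ℂ) (f : ℝ → ℝ)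
    (c : Fin n → ℝ) (h : IsSelfAdjoint (φ c)) : cfc f (φ c) = φ (f ∘ c) := by
  classical
  -- On the finite spectrum `f` agrees with a polynomial, and algebra homomorphisms commute with
  -- polynomials.
  let q : ℝ[X] := Lagrange.interpolate (Finset.univ.image c) id f
  have hq : ∀ i, q.eval (c i) = f (c i) := fun i =>
    Lagrange.eval_interpolate_at_node f (v := id) Function.injective_id.injOn
      (Finset.mem_image_of_mem c (Finset.mem_univ i))
  have hspec : spectrum ℝ (φ c) ⊆ Set.range c := by
    refine (AlgHom.spectrum_apply_subset φ c).trans ?_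
    rw [Pi.spectrum_eq]
    refine Set.iUnion_subset fun i => ?_
    rw [← Algebra.algebraMap_self_apply (c i), spectrum.scalar_eq, Set.singleton_subset_iff]
    exact Set.mem_range_self i
  calc cfc f (φ c) = cfc q.eval (φ c) := cfc_congr fun x hx => by
        obtain ⟨i, rfl⟩ := hspec hx
        exact (hq i).symm
    _ = aeval (φ c) q := cfc_polynomial q _ h
    _ = φ (aeval c q) := aeval_algHom_apply φ c q
    _ = φ (f ∘ c) := by
      congr 1
      funext i
      simp [hq]

/-- The algebra homomorphism `c ↦ U diag(c) U*`. -/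
noncomputable def conjDiagonalAlgHom {n : ℕ} (U : Matrix.unitaryGroup (Fin n) ℂ) :
    (Fin n → ℝ) →ₐ[ℝ] Matrix (Fin n) (Fin n) ℂ :=
  ((Unitary.conjStarAlgAut ℝ (Matrix (Fin n) (Fin n) ℂ) U).toAlgEquiv.toAlgHom.comp
    (Matrix.diagonalAlgHom ℝ)).comp (Complex.ofRealAm.compLeft (Fin n))

theorem isHermitian_conj_diagonal {n : ℕ} (U : Matrix (Fin n) (Fin n) ℂ) (c : Fin n → ℝ) :
    (U * Matrix.diagonal (fun i => (c i : ℂ)) * star U).IsHermitian :=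
  Matrix.isHermitian_mul_mul_conjTranspose U
    (Matrix.isHermitian_diagonal_iff.2 fun _ => Complex.conj_ofReal _)

theorem matLog_conj_diagonal {n : ℕ} {U : Matrix (Fin n) (Fin n) ℂ}
    (hU : U ∈ Matrix.unitaryGroup (Fin n) ℂ) (c : Fin n → ℝ) :
    matLog (U * Matrix.diagonal (fun i => (c i : ℂ)) * star U) =
      U * Matrix.diagonal (fun i => (Real.logb 2 (c i) : ℂ)) * star U :=
  cfc_algHom_apply (conjDiagonalAlgHom ⟨U, hU⟩) (Real.logb 2) c
    (isHermitian_conj_diagonal U c).isSelfAdjoint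

theorem matLog_diagonal {n : ℕ} (c : Fin n → ℝ) :
    matLog (Matrix.diagonal fun i => (c i : ℂ)) =
      Matrix.diagonal fun i => (Real.logb 2 (c i) : ℂ) := by
  simpa using matLog_conj_diagonal (one_mem (Matrix.unitaryGroup (Fin n) ℂ)) c

theorem conj_mul_conj {n : ℕ} {U : Matrix (Fin n) (Fin n) ℂ}
    (hU : U ∈ Matrix.unitaryGroup (Fin n) ℂ) (A B : Matrix (Fin n) (Fin n) ℂ) :
    U * A * star U * (U * B * star U) = U * (A * B) * star U := by
  calc U * A * star U * (U * B * star U) = U * A * (star U * U) * B * star U := by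
        simp only [mul_assoc]
    _ = U * (A * B) * star U := by
        rw [Matrix.mem_unitaryGroup_iff'.1 hU, mul_one]
        simp only [mul_assoc]

theorem charpoly_conj {n : ℕ} {U : Matrix (Fin n) (Fin n) ℂ}
    (hU : U ∈ Matrix.unitaryGroup (Fin n) ℂ) (A : Matrix (Fin n) (Fin n) ℂ) :
    (U * A * star U).charpoly = A.charpoly := by
  rw [Matrix.charpoly_mul_comm, ← mul_assoc, Matrix.mem_unitaryGroup_iff'.1 hU, one_mul]

theorem trace_conj {n : ℕ} {U : Matrix (Fin n) (Fin n) ℂ}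
    (hU : U ∈ Matrix.unitaryGroup (Fin n) ℂ) (A : Matrix (Fin n) (Fin n) ℂ) :
    (U * A * star U).trace = A.trace := by
  rw [Matrix.trace_mul_comm, ← mul_assoc, Matrix.mem_unitaryGroup_iff'.1 hU, one_mul]

theorem hasSpectrum_conj_diagonal {n : ℕ} {U : Matrix (Fin n) (Fin n) ℂ}
    (hU : U ∈ Matrix.unitaryGroup (Fin n) ℂ) (c : Fin n → ℝ) :
    HasSpectrum (U * Matrix.diagonal (fun i => (c i : ℂ)) * star U) c := by
  rw [HasSpectrum, charpoly_conj hU, Matrix.charpoly_diagonal, Polynomial.roots_prod]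
  · simp
  · exact Finset.prod_ne_zero_iff.2 fun i _ => Polynomial.X_sub_C_ne_zero _

theorem isState_conj_diagonal {n : ℕ} {U : Matrix (Fin n) (Fin n) ℂ}
    (hU : U ∈ Matrix.unitaryGroup (Fin n) ℂ) {c : Fin n → ℝ} (hc : c ∈ stdSimplex ℝ (Fin n)) :
    IsState (U * Matrix.diagonal (fun i => (c i : ℂ)) * star U) where
  posSemidef := Matrix.PosSemidef.mul_mul_conjTranspose_same
    (Matrix.posSemidef_diagonal_iff.2 fun i => by exact_mod_cast hc.1 i) U
  trace_eq_one := by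
    rw [trace_conj hU, Matrix.trace_diagonal]
    exact_mod_cast hc.2

theorem trace_mul_matLog_self {n : ℕ} {U : Matrix (Fin n) (Fin n) ℂ}
    (hU : U ∈ Matrix.unitaryGroup (Fin n) ℂ) (c : Fin n → ℝ) :
    (U * Matrix.diagonal (fun i => (c i : ℂ)) * star U *
      matLog (U * Matrix.diagonal (fun i => (c i : ℂ)) * star U)).trace.re = -shannonEntropy c := by
  rw [matLog_conj_diagonal hU, conj_mul_conj hU, trace_conj hU, Matrix.diagonal_mul_diagonal,
    Matrix.trace_diagonal, shannonEntropy, neg_neg]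
  simp

theorem trace_mul_matLog_diagonal {n : ℕ} {ρ : Matrix (Fin n) (Fin n) ℂ} {d : Fin n → ℝ}
    (hd : ∀ i, ρ i i = (d i : ℂ)) (q : Fin n → ℝ) :
    (ρ * matLog (Matrix.diagonal fun i => (q i : ℂ))).trace.re =
      ∑ i, d i * Real.logb 2 (q i) := by
  rw [matLog_diagonal]
  simp [Matrix.trace, hd]

/-! ### Relative entropy of coherence -/

/-- Gibbs' inequality. -/
theorem sum_mul_logb_le {n : ℕ} {d q : Fin n → ℝ} (hd : d ∈ stdSimplex ℝ (Fin n))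
    (hq : q ∈ stdSimplex ℝ (Fin n)) (h : ∀ i, q i = 0 → d i = 0) :
    ∑ i, d i * Real.logb 2 (q i) ≤ ∑ i, d i * Real.logb 2 (d i) := by
  -- This is `log x ≤ x - 1` at `x = q i / d i`, multiplied by `d i`.
  have key : ∀ i, d i * Real.log (q i) - d i * Real.log (d i) ≤ q i - d i := by
    intro i
    rcases (hd.1 i).eq_or_lt with h₀ | h₀
    · simpa [← h₀] using hq.1 i
    · have hqi : 0 < q i := (hq.1 i).lt_of_ne fun h' => h₀.ne' (h i h'.symm)
      have := mul_le_mul_of_nonneg_left (Real.log_le_sub_one_of_pos (div_pos hqi h₀)) h₀.le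
      rw [Real.log_div hqi.ne' h₀.ne', mul_sub, mul_sub, mul_div_cancel₀ _ h₀.ne', mul_one] at this
      exact this
  have hsum := Finset.sum_le_sum fun i (_ : i ∈ Finset.univ) => key i
  rw [Finset.sum_sub_distrib, Finset.sum_sub_distrib, hd.2, hq.2] at hsum
  simp only [Real.logb, ← mul_div_assoc, ← Finset.sum_div]
  exact div_le_div_of_nonneg_right (by linarith) (Real.log_nonneg one_le_two)

/-- A positive semidefinite matrix vanishes on the kernel of its diagonal part. -/
theorem mulVec_eq_zero_of_diagonal_mulVec_eq_zero {n : ℕ} {ρ : Matrix (Fin n) (Fin n) ℂ}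
    (hρ : ρ.PosSemidef) {v : Fin n → ℂ}
    (hv : (Matrix.diagonal fun i => ρ i i).mulVec v = 0) : ρ.mulVec v = 0 := by
  funext i
  change ∑ j, ρ i j * v j = 0
  refine Finset.sum_eq_zero fun j _ => ?_
  have hj := congrFun hv j
  rw [Matrix.mulVec_diagonal] at hj
  rcases mul_eq_zero.1 hj with h | h
  -- For a positive semidefinite matrix, `eⱼ* ρ eⱼ = 0` forces `ρ eⱼ = 0`.
  · have h₀ := (hρ.dotProduct_mulVec_zero_iff (Pi.single j 1)).1 (by
      rw [← Pi.single_star, star_one]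
      simpa using h)
    have := congrFun h₀ i
    rw [Matrix.mulVec_single_one, Matrix.col_apply, Pi.zero_apply] at this
    rw [this, zero_mul]
  · rw [h, mul_zero]

/-- The relative entropy of coherence is the entropy of the diagonal minus that of the
spectrum. -/
theorem relEntropyCoherenceEq_conj_diagonal {n : ℕ} {U : Matrix (Fin n) (Fin n) ℂ}
    (hU : U ∈ Matrix.unitaryGroup (Fin n) ℂ) {c d : Fin n → ℝ} (hc : c ∈ stdSimplex ℝ (Fin n))
    (hd : d ∈ stdSimplex ℝ (Fin n))
    (h : ∀ i, (U * Matrix.diagonal (fun i => (c i : ℂ)) * star U) i i = (d i : ℂ)) :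
    RelEntropyCoherenceEq (U * Matrix.diagonal (fun i => (c i : ℂ)) * star U)
      (shannonEntropy d - shannonEntropy c) := by
  have hent : ∀ q : Fin n → ℝ, ((U * Matrix.diagonal (fun i => (c i : ℂ)) * star U *
      matLog (U * Matrix.diagonal (fun i => (c i : ℂ)) * star U) -
      U * Matrix.diagonal (fun i => (c i : ℂ)) * star U *
        matLog (Matrix.diagonal fun i => (q i : ℂ))).trace.re) =
      -shannonEntropy c - ∑ i, d i * Real.logb 2 (q i) := fun q => by
    rw [Matrix.trace_sub, Complex.sub_re, trace_mul_matLog_self hU, trace_mul_matLog_diagonal h]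
  have hpsd := (isState_conj_diagonal hU hc).posSemidef
  refine ⟨⟨_, ⟨d, hd, rfl⟩, ?_⟩, ?_⟩
  · rw [relativeEntropy, if_pos, hent]
    · congr 1
      rw [shannonEntropy]
      ring
    · intro v hv
      refine mulVec_eq_zero_of_diagonal_mulVec_eq_zero hpsd ?_
      simpa only [h] using hv
  · rintro _ ⟨_, ⟨q, hq, rfl⟩, rfl⟩
    rw [relativeEntropy]
    split_ifs with hker
    · rw [hent, EReal.coe_le_coe_iff]
      -- If `q i = 0`, then `eᵢ` lies in both kernels, so `d i = 0`. Without this the convention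
      -- `Real.logb 2 0 = 0` would spoil Gibbs' inequality.
      have := sum_mul_logb_le hd hq fun i hi => by
        have h₀ := congrFun (hker (Pi.single i 1) (by
          funext j
          by_cases hij : j = i
          · subst hij; simp [hi]
          · simp [hij])) i
        rw [Matrix.mulVec_single_one, Matrix.col_apply, h, Pi.zero_apply] at h₀
        exact_mod_cast h₀
      rw [shannonEntropy]
      linarith
    · exact le_top

/-! ### The measurement and the main theorem -/

/-- The projectors onto the columns of a unitary matrix form a von Neumann measurement. -/
theorem isVonNeumannMeasurement_conj_single {n : ℕ} {W : Matrix (Fin n) (Fin n) ℂ}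
    (hW : W ∈ Matrix.unitaryGroup (Fin n) ℂ) :
    IsVonNeumannMeasurement fun i => W * Matrix.single i i 1 * star W := by
  have hdet : IsUnit W.det := (Matrix.isUnit_iff_isUnit_det W).1
    ⟨⟨W, star W, Matrix.mem_unitaryGroup_iff.1 hW, Matrix.mem_unitaryGroup_iff'.1 hW⟩, rfl⟩
  have hdet' : IsUnit (star W).det := (Matrix.isUnit_iff_isUnit_det _).1
    ⟨⟨star W, W, Matrix.mem_unitaryGroup_iff'.1 hW, Matrix.mem_unitaryGroup_iff.1 hW⟩, rfl⟩
  refine ⟨fun i => ?_, fun i => ?_, fun i j hij => ?_, fun i => ?_, ?_⟩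
  · exact Matrix.isHermitian_mul_mul_conjTranspose W (by simp [Matrix.IsHermitian])
  · rw [conj_mul_conj hW]; simp
  · rw [conj_mul_conj hW]; simp [hij]
  · rw [Matrix.rank_mul_eq_left_of_isUnit_det _ _ hdet',
      Matrix.rank_mul_eq_right_of_isUnit_det _ _ hdet, ← Matrix.diagonal_single, Matrix.rank_diagonal]
    simp [Pi.single_apply]
  · have h1 : ∑ i : Fin n, Matrix.single i i (1 : ℂ) = 1 := by
      ext i j
      simp [Matrix.sum_apply, Matrix.single_apply, Matrix.one_apply, ite_and]
    rw [← Finset.sum_mul, ← Finset.mul_sum, h1, mul_one, Matrix.mem_unitaryGroup_iff.1 hW]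

theorem trace_conj_single_mul {n : ℕ} (W A : Matrix (Fin n) (Fin n) ℂ) (i : Fin n) :
    (W * Matrix.single i i 1 * star W * A).trace = (star W * A * W) i i := by
  rw [mul_assoc, mul_assoc, Matrix.trace_mul_comm, mul_assoc, Matrix.trace_single_mul]
  simp [mul_assoc]

end CoherenceEstimation

theorem mainTheorem4 (n : ℕ) (d p : Fin n → ℝ)
    (hd : d ∈ stdSimplex ℝ (Fin n)) (hp : p ∈ stdSimplex ℝ (Fin n)) :
    (∃! c : Fin n → ℝ, Antitone c ∧ CoherenceEstimation.IsMajorizationJoin d p c) ∧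
    ∀ c : Fin n → ℝ, CoherenceEstimation.IsMajorizationJoin d p c →
      ∃ (ρ : Matrix (Fin n) (Fin n) ℂ) (P : Fin n → Matrix (Fin n) (Fin n) ℂ),
        CoherenceEstimation.IsState ρ ∧
        CoherenceEstimation.IsVonNeumannMeasurement P ∧
        (∀ i, ρ i i = (d i : ℂ)) ∧
        (∀ i, (P i * ρ).trace = (p i : ℂ)) ∧
        CoherenceEstimation.HasSpectrum ρ c ∧
        CoherenceEstimation.RelEntropyCoherenceEq ρ
          (CoherenceEstimation.shannonEntropy d - CoherenceEstimation.shannonEntropy c) := by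
  refine ⟨CoherenceEstimation.existsUnique_antitone_isMajorizationJoin hd hp, fun c hc => ?_⟩
  obtain ⟨U, hU, hUd⟩ :=
    CoherenceEstimation.Majorizes.exists_unitary_conj_diagonal hc.majorizes_left
      (hc.mem_simplex.2.trans hd.2.symm)
  obtain ⟨V, hV, hVp⟩ :=
    CoherenceEstimation.Majorizes.exists_unitary_conj_diagonal hc.majorizes_right
      (hc.mem_simplex.2.trans hp.2.symm)
  refine ⟨_, _, CoherenceEstimation.isState_conj_diagonal hU hc.mem_simplex,
    CoherenceEstimation.isVonNeumannMeasurement_conj_single (mul_mem hU (Unitary.star_mem hV)),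
    hUd, fun i => ?_, CoherenceEstimation.hasSpectrum_conj_diagonal hU c,
    CoherenceEstimation.relEntropyCoherenceEq_conj_diagonal hU hc.mem_simplex hd hUd⟩
  rw [CoherenceEstimation.trace_conj_single_mul, ← hVp i]
  rw [star_mul, star_star]
  refine congrFun (congrFun ?_ i) i
  -- With `W = U V*` the factors of `U` cancel in `W* ρ W`.
  calc V * star U * (U * Matrix.diagonal (fun i => (c i : ℂ)) * star U) * (U * star V)
      = V * (star U * U) * Matrix.diagonal (fun i => (c i : ℂ)) * (star U * U) * star V := by
        simp only [mul_assoc]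
    _ = _ := by rw [Matrix.mem_unitaryGroup_iff'.1 hU, mul_one, mul_one]
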